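/- Fix $L>0$. Call a function $V:\mathbb R^d\to\mathbb R$ convex and $L$-smooth if it is convex, continuously differentiable, and $\|\nabla V(x)-\nabla V(y)\|\le L\|x-y\|$ for all $x,y\in\mathbb R^d$ (Euclidean norm). An $s$-stage Runge--Kutta (RK) scheme with coefficients $a_{ij}$ and weights $b_j$, applied with step $h$ to $\frac{d}{dt}x=F(x)$, takes $x_0$ to $x_1=x_0+h\sum_{j}b_jF(X_j)$, where the stages satisfy $X_i=x_0+h\sum_j a_{ij}F(X_j)$, $i=1,\dots,s$. An interval $(0,h_c]$ with $h_c=h_c(L)>0$ is an interval of convex contractivity of an RK scheme if, for every $h\in(0,h_c]$, every $d$, every convex and $L$-smooth $V$ on $\mathbb R^d$ and any two initial points $x_0,\widetilde x_0\in\mathbb R^d$, the results $x_1,\widetilde x_1$ of one step of the scheme with step $h$ for the gradient system $\frac{d}{dt}x=-\nabla V(x)$ satisfy $\|\widetilde x_1-x_1\|\le\|\widetilde x_0-x_0\|$. Consider Runge's explicit second-order method $$y_1=y_0+hF\Big(y_0+\frac h2F(y_0)\Big),$$ that is, the two-stage RK scheme with $a_{21}=\frac12$, $a_{11}=a_{12}=a_{22}=0$,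 $b_1=0$, $b_2=1$. For every $h>0$ there exist a convex and $L$-smooth potential $V$ on $\mathbb R^2$ and initial points $x_0,\widetilde x_0\in\mathbb R^2$ such that one step of this method with $F=-\nabla V$ gives $$\|\widetilde x_1-x_1\|>\|\widetilde x_0-x_0\|.$$ As a consequence, the method has no interval of convex contractivity. -/

import Mathlib

/-- `V` is convex, continuously differentiable, and its gradient is globally Lipschitz
continuous with constant `L`. -/
structure IsConvexLSmooth {d : ℕ} (L : ℝ) (V : EuclideanSpace ℝ (Fin d) → ℝ) : Prop where
  convex : ConvexOn ℝ Set.univ V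
  contDiff : ContDiff ℝ 1 V
  lipschitz_gradient : ∀ x y, ‖gradient V x - gradient V y‖ ≤ L * ‖x - y‖

/-- An `s`-stage Runge-Kutta scheme, given by its coefficients `a i j` and weights `b j`. -/
structure RKScheme (s : ℕ) where
  a : Fin s → Fin s → ℝ
  b : Fin s → ℝ

/-- `x₁` is obtained from `x₀` by one step of length `h` of the scheme, applied to
`dx/dt = F x`; the `X i` are the stage vectors. -/
def RKScheme.IsStep {s d : ℕ} (S : RKScheme s) (h : ℝ)
    (F : EuclideanSpace ℝ (Fin d) → EuclideanSpace ℝ (Fin d))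
    (x₀ x₁ : EuclideanSpace ℝ (Fin d)) : Prop :=
  ∃ X : Fin s → EuclideanSpace ℝ (Fin d),
    (∀ i, X i = x₀ + h • ∑ j, S.a i j • F (X j)) ∧
      x₁ = x₀ + h • ∑ j, S.b j • F (X j)

/-- `(0, hc]` is an interval of convex contractivity of the scheme, for the Lipschitz constant
`L`: in every dimension, for every `h ∈ (0, hc]` and every convex `L`-smooth potential `V`, one
step of length `h` for `dx/dt = -∇V(x)` does not increase the distance of any two points. -/
def RKScheme.IsIntervalOfConvexContractivity {s : ℕ} (S : RKScheme s) (L hc : ℝ) : Prop :=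
  0 < hc ∧ ∀ h ∈ Set.Ioc 0 hc, ∀ (d : ℕ) (V : EuclideanSpace ℝ (Fin d) → ℝ),
    IsConvexLSmooth L V → ∀ x₀ y₀ x₁ y₁ : EuclideanSpace ℝ (Fin d),
      S.IsStep h (fun x => -gradient V x) x₀ x₁ → S.IsStep h (fun x => -gradient V x) y₀ y₁ →
        ‖y₁ - x₁‖ ≤ ‖y₀ - x₀‖

/-- One step of Runge's explicit second-order method. -/
noncomputable def rungeStep {d : ℕ} (h : ℝ)
    (F : EuclideanSpace ℝ (Fin d) → EuclideanSpace ℝ (Fin d))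
    (y₀ : EuclideanSpace ℝ (Fin d)) : EuclideanSpace ℝ (Fin d) :=
  y₀ + h • F (y₀ + (h / 2) • F y₀)

/-- Runge's explicit second-order method as a two-stage Runge-Kutta scheme. -/
noncomputable def rungeScheme : RKScheme 2 where
  a := ![![0, 0], ![1 / 2, 0]]
  b := ![0, 1]

/-- A step of the two-stage scheme is a step of Runge's method in its explicit form. -/
theorem rungeScheme_isStep_iff {d : ℕ} (h : ℝ)
    (F : EuclideanSpace ℝ (Fin d) → EuclideanSpace ℝ (Fin d))
    (x₀ x₁ : EuclideanSpace ℝ (Fin d)) :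
    rungeScheme.IsStep h F x₀ x₁ ↔ x₁ = rungeStep h F x₀ := by
  constructor
  · rintro ⟨X, hX, hx⟩
    have h0 : X 0 = x₀ := by simpa [rungeScheme] using hX 0
    have h1 : X 1 = x₀ + (h / 2) • F x₀ := by
      have := hX 1
      simpa [rungeScheme, Fin.sum_univ_two, h0, smul_smul, div_eq_mul_inv] using this
    simpa [rungeScheme, Fin.sum_univ_two, h1, rungeStep] using hx
  · rintro rfl
    refine ⟨![x₀, x₀ + (h / 2) • F x₀], ?_, ?_⟩
    · intro i
      fin_cases i <;> simp [rungeScheme, Fin.sum_univ_two, smul_smul, div_eq_mul_inv]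
    · simp [rungeScheme, Fin.sum_univ_two, rungeStep]

/-! Start from two points differing by `(0, 1)` and let `V` add a one-sided quadratic ridge in `x 0
+ x 1` to a quadratic in `x 0`. The ridge acts on only one of the two initial gradients, so the half
step makes the first coordinates differ by `-h * c / 2`. If `x 0` is large enough, both second
stages lie where the ridge is flat and the gradient is `(c * x 0, 0)`. The update then adds `(h * c)
^ 2 / 2` orthogonally to the initial difference, which lengthens it for every `h > 0`
(`rungeStep_ridgeGradient_sub`). -/

/-- A function that lies above all its tangent hyperplanes is convex. -/
theorem convexOn_univ_of_add_inner_le {E : Type*} [NormedAddCommGroup E] [InnerProductSpace ℝ E]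
    {V : E → ℝ} {g : E → E} (hg : ∀ x y, V x + inner ℝ (g x) (y - x) ≤ V y) :
    ConvexOn ℝ Set.univ V := by
  refine ⟨convex_univ, fun x _ y _ a b ha hb hab => ?_⟩
  -- Both tangents are taken at the convex combination, so their weighted linear terms cancel.
  have h1 := mul_le_mul_of_nonneg_left (hg (a • x + b • y) x) ha
  have h2 := mul_le_mul_of_nonneg_left (hg (a • x + b • y) y) hb
  have h3 : a • (x - (a • x + b • y)) + b • (y - (a • x + b • y)) = 0 := by
    obtain rfl : b = 1 - a := by linarith
    module
  have h4 : a * inner ℝ (g (a • x + b • y)) (x - (a • x + b • y)) +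
      b * inner ℝ (g (a • x + b • y)) (y - (a • x + b • y)) = 0 := by
    rw [← real_inner_smul_right, ← real_inner_smul_right, ← inner_add_right, h3,
      inner_zero_right]
  have h5 : a * V (a • x + b • y) + b * V (a • x + b • y) = V (a • x + b • y) := by
    rw [← add_mul, hab, one_mul]
  simp only [smul_eq_mul]
  linarith

/-- A function with a quadratic first-order Taylor remainder is differentiable. -/
theorem hasGradientAt_of_abs_sub_inner_le {E : Type*} [NormedAddCommGroup E]
    [InnerProductSpace ℝ E] [CompleteSpace E] {V : E → ℝ} {g x : E} {C : ℝ}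
    (hV : ∀ y, |V y - V x - inner ℝ g (y - x)| ≤ C * ‖y - x‖ ^ 2) : HasGradientAt V g x := by
  rw [hasGradientAt_iff_isLittleO]
  refine Asymptotics.IsBigO.trans_isLittleO (g := fun y => ‖y - x‖ ^ 2) ?_ ?_
  · refine Asymptotics.IsBigO.of_bound C (Filter.Eventually.of_forall fun y => ?_)
    simpa using hV y
  · exact Asymptotics.isLittleO_pow_sub_sub x one_lt_two

/-- The derivative `2 * max s 0` is nondecreasing and 2-Lipschitz, so the Taylor remainder lies
between `0` and `(t - s) ^ 2`. The lower bound yields convexity; together they yield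
differentiability. -/
theorem max_zero_sq_sub_tangent_nonneg (s t : ℝ) :
    0 ≤ max t 0 ^ 2 - max s 0 ^ 2 - 2 * max s 0 * (t - s) := by
  rcases max_cases s 0 with ⟨h, h'⟩ | ⟨h, h'⟩ <;> rcases max_cases t 0 with ⟨k, k'⟩ | ⟨k, k'⟩ <;>
    rw [h, k] <;> nlinarith [sq_nonneg (t - s)]

theorem max_zero_sq_sub_tangent_le (s t : ℝ) :
    max t 0 ^ 2 - max s 0 ^ 2 - 2 * max s 0 * (t - s) ≤ (t - s) ^ 2 := by
  rcases max_cases s 0 with ⟨h, h'⟩ | ⟨h, h'⟩ <;> rcases max_cases t 0 with ⟨k, k'⟩ | ⟨k, k'⟩ <;>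
    rw [h, k] <;> nlinarith

/-- The sum of a one-sided quadratic in the direction `(1, 1)` and a quadratic in the direction
`(1, 0)`. -/
noncomputable def ridgePotential (c : ℝ) (x : EuclideanSpace ℝ (Fin 2)) : ℝ :=
  c / 2 * (max (x 0 + x 1) 0 ^ 2 + x 0 ^ 2)

/-- The gradient of `ridgePotential`. -/
noncomputable def ridgeGradient (c : ℝ) (x : EuclideanSpace ℝ (Fin 2)) :
    EuclideanSpace ℝ (Fin 2) :=
  !₂[c * (max (x 0 + x 1) 0 + x 0), c * max (x 0 + x 1) 0]

theorem ridgePotential_sub_tangent (c : ℝ) (x y : EuclideanSpace ℝ (Fin 2)) :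
    ridgePotential c y - ridgePotential c x - inner ℝ (ridgeGradient c x) (y - x) =
      c / 2 * ((max (y 0 + y 1) 0 ^ 2 - max (x 0 + x 1) 0 ^ 2 -
        2 * max (x 0 + x 1) 0 * ((y 0 + y 1) - (x 0 + x 1))) + (y 0 - x 0) ^ 2) := by
  simp only [ridgePotential, ridgeGradient, PiLp.inner_apply, Fin.sum_univ_two, PiLp.sub_apply,
    RCLike.inner_apply, conj_trivial, Matrix.cons_val_zero, Matrix.cons_val_one]
  ring

theorem ridgePotential_sub_tangent_nonneg {c : ℝ} (hc : 0 ≤ c) (x y : EuclideanSpace ℝ (Fin 2)) :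
    0 ≤ ridgePotential c y - ridgePotential c x - inner ℝ (ridgeGradient c x) (y - x) := by
  rw [ridgePotential_sub_tangent]
  have := max_zero_sq_sub_tangent_nonneg (x 0 + x 1) (y 0 + y 1)
  positivity

theorem hasGradientAt_ridgePotential {c : ℝ} (hc : 0 ≤ c) (x : EuclideanSpace ℝ (Fin 2)) :
    HasGradientAt (ridgePotential c) (ridgeGradient c x) x := by
  refine hasGradientAt_of_abs_sub_inner_le (C := c / 2 * 3) fun y => ?_
  rw [abs_of_nonneg (ridgePotential_sub_tangent_nonneg hc x y), ridgePotential_sub_tangent,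
    mul_assoc (c / 2) 3]
  refine mul_le_mul_of_nonneg_left ?_ (div_nonneg hc zero_le_two)
  have := max_zero_sq_sub_tangent_le (x 0 + x 1) (y 0 + y 1)
  rw [EuclideanSpace.real_norm_sq_eq]
  simp only [Fin.sum_univ_two, PiLp.sub_apply]
  nlinarith [sq_nonneg ((y 0 - x 0) - (y 1 - x 1)), sq_nonneg (y 1 - x 1)]

theorem gradient_ridgePotential {c : ℝ} (hc : 0 ≤ c) :
    gradient (ridgePotential c) = ridgeGradient c :=
  funext fun x => (hasGradientAt_ridgePotential hc x).gradient

theorem norm_ridgeGradient_sub_le {c : ℝ} (hc : 0 ≤ c) (x y : EuclideanSpace ℝ (Fin 2)) :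
    ‖ridgeGradient c x - ridgeGradient c y‖ ≤ 3 * c * ‖x - y‖ := by
  refine le_of_sq_le_sq ?_ (by positivity)
  rw [mul_pow, EuclideanSpace.real_norm_sq_eq, EuclideanSpace.real_norm_sq_eq]
  simp only [ridgeGradient, Fin.sum_univ_two, PiLp.sub_apply, Matrix.cons_val_zero,
    Matrix.cons_val_one]
  have hp := sq_le_sq.2 (abs_max_sub_max_le_abs (x 0 + x 1) (y 0 + y 1) 0)
  generalize max (x 0 + x 1) 0 = p at *
  generalize max (y 0 + y 1) 0 = q at *
  have key : (p - q + (x 0 - y 0)) ^ 2 + (p - q) ^ 2 ≤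
      9 * ((x 0 - y 0) ^ 2 + (x 1 - y 1) ^ 2) := by
    nlinarith [sq_nonneg (p - q - (x 0 - y 0)), sq_nonneg ((x 0 - y 0) - (x 1 - y 1)),
      sq_nonneg (x 0 - y 0), sq_nonneg (x 1 - y 1)]
  have := mul_le_mul_of_nonneg_left key (sq_nonneg c)
  linarith

theorem isConvexLSmooth_ridgePotential {c : ℝ} (hc : 0 ≤ c) :
    IsConvexLSmooth (3 * c) (ridgePotential c) where
  convex := convexOn_univ_of_add_inner_le (g := ridgeGradient c) fun x y => by
    linarith [ridgePotential_sub_tangent_nonneg hc x y]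
  contDiff := by
    rw [contDiff_one_iff_fderiv]
    refine ⟨fun x => (hasGradientAt_ridgePotential hc x).differentiableAt, ?_⟩
    have hcont : Continuous (ridgeGradient c) :=
      (LipschitzWith.of_dist_le' (K := 3 * c) fun x y => by
        simpa [dist_eq_norm] using norm_ridgeGradient_sub_le hc x y).continuous
    have hfd : fderiv ℝ (ridgePotential c) =
        fun x => InnerProductSpace.toDual ℝ _ (ridgeGradient c x) :=
      funext fun x => (hasGradientAt_ridgePotential hc x).hasFDerivAt.fderiv
    rw [hfd]
    exact (InnerProductSpace.toDual ℝ _).continuous.comp hcont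
  lipschitz_gradient x y := by
    rw [gradient_ridgePotential hc]
    exact norm_ridgeGradient_sub_le hc x y

/-- The second stages of Runge's method from `(X, -X)` and `(X, 1 - X)`, where `h * c * X = 2`,
lie in the half-plane in which `ridgePotential c` depends on the first coordinate only. -/
theorem rungeStep_ridgeGradient_sub {c h X : ℝ} (hc : 0 < c) (hh : 0 < h) (hX : h * c * X = 2) :
    rungeStep h (fun x => -ridgeGradient c x) !₂[X, 1 - X] -
      rungeStep h (fun x => -ridgeGradient c x) !₂[X, -X] = !₂[(h * c) ^ 2 / 2, 1] := by
  have hhc : 0 < h * c := mul_pos hh hc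
  -- As `h * c * X = 2`, the coordinate sums at the second stages are `-h * c` here and `-1` in
  -- `e2`.
  have e1 : max (X + h / 2 * -(c * (1 + X)) + (1 - X + h / 2 * -c)) 0 = 0 :=
    max_eq_right (by nlinarith)
  have e2 : max (X + h / 2 * -(c * X) + -X) 0 = 0 := max_eq_right (by nlinarith)
  ext i
  fin_cases i <;>
    simp only [rungeStep, ridgeGradient, PiLp.sub_apply, PiLp.add_apply, PiLp.smul_apply,
      PiLp.neg_apply, smul_eq_mul, Fin.zero_eta, Fin.mk_one, Matrix.cons_val_zero,
      Matrix.cons_val_one, add_sub_cancel, add_neg_cancel, max_self, max_eq_left zero_le_one,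
      mul_one, zero_add, mul_zero, neg_zero, add_zero]
  all_goals
    rw [e1, e2]
    ring

theorem exists_norm_sub_lt_norm_rungeStep_sub {L h : ℝ} (hL : 0 < L) (hh : 0 < h) :
    ∃ (V : EuclideanSpace ℝ (Fin 2) → ℝ) (x₀ y₀ : EuclideanSpace ℝ (Fin 2)),
      IsConvexLSmooth L V ∧
        ‖y₀ - x₀‖ < ‖rungeStep h (fun x => -gradient V x) y₀ -
          rungeStep h (fun x => -gradient V x) x₀‖ := by
  have hc : 0 < L / 3 := by positivity
  -- `c = L / 3` makes the Lipschitz constant `3 * c` equal to `L`.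
  refine ⟨ridgePotential (L / 3), !₂[2 / (h * (L / 3)), -(2 / (h * (L / 3)))],
    !₂[2 / (h * (L / 3)), 1 - 2 / (h * (L / 3))], ?_, ?_⟩
  · simpa [mul_div_cancel₀] using isConvexLSmooth_ridgePotential hc.le
  · rw [gradient_ridgePotential hc.le, rungeStep_ridgeGradient_sub hc hh (by field_simp)]
    refine lt_of_pow_lt_pow_left₀ 2 (norm_nonneg _) ?_
    rw [EuclideanSpace.real_norm_sq_eq, EuclideanSpace.real_norm_sq_eq]
    simp only [Fin.sum_univ_two, PiLp.sub_apply, Matrix.cons_val_zero, Matrix.cons_val_one]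
    have : 0 < ((h * (L / 3)) ^ 2 / 2) ^ 2 := by positivity
    linarith

theorem theorem3 (L : ℝ) (hL : 0 < L) :
    (∀ h : ℝ, 0 < h → ∃ (V : EuclideanSpace ℝ (Fin 2) → ℝ) (x₀ y₀ : EuclideanSpace ℝ (Fin 2)),
      IsConvexLSmooth L V ∧
        ‖y₀ - x₀‖ < ‖rungeStep h (fun x => -gradient V x) y₀ -
          rungeStep h (fun x => -gradient V x) x₀‖) ∧
    ¬ ∃ hc : ℝ, rungeScheme.IsIntervalOfConvexContractivity L hc := by
  refine ⟨fun h hh => exists_norm_sub_lt_norm_rungeStep_sub hL hh, ?_⟩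
  rintro ⟨hc, hpos, hcontr⟩
  obtain ⟨V, x₀, y₀, hV, hlt⟩ := exists_norm_sub_lt_norm_rungeStep_sub hL hpos
  exact hlt.not_ge (hcontr hc ⟨hpos, le_rfl⟩ 2 V hV x₀ y₀ _ _
    ((rungeScheme_isStep_iff _ _ _ _).2 rfl) ((rungeScheme_isStep_iff _ _ _ _).2 rfl))
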